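/- Let $X$ be an infinite-dimensional real Banach space with closed unit ball $B_X$, unit sphere $S_X$ and topological dual $X^*$. For $x^*\in S_{X^*}$ and $\varepsilon>0$ write $S(x^*,\varepsilon)=\{z\in B_X : x^*(z)>1-\varepsilon\}$. Suppose that $X$ is lush, that is, for all $x,y\in S_X$ and every $\varepsilon>0$ there is $x^*\in S_{X^*}$ such that $x\in S(x^*,\varepsilon)$ and $\mathrm{dist}\bigl(y,\mathrm{aco}(S(x^*,\varepsilon))\bigr)<\varepsilon$, where $\mathrm{aco}$ denotes the absolutely convex hull. Then $X^*$ contains an isomorphic copy of $\ell_1$; that is, there is a linear subspace of $X^*$ which, with the norm of $X^*$, is linearly homeomorphic to the real sequence space $\ell_1$. -/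

import Mathlib

/-- The open slice `S(f, ε) = {z ∈ B_X : f z > 1 - ε}` of the closed unit ball of a real normed
space, determined by a functional `f` and a number `ε`. -/
def ballSlice {X : Type*} [NormedAddCommGroup X] [NormedSpace ℝ X]
    (f : StrongDual ℝ X) (ε : ℝ) : Set X :=
  {z | ‖z‖ ≤ 1 ∧ 1 - ε < f z}

/-- A real normed space `X` is lush if for all `x, y` in the unit sphere and every `ε > 0` there is
a norm-one functional `f` such that `x` lies in the slice `S(f, ε)` and the distance from `y` to
the absolutely convex hull of `S(f, ε)` is less than `ε`. -/
def IsLush (X : Type*) [NormedAddCommGroup X] [NormedSpace ℝ X] : Prop :=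
  ∀ x y : X, ‖x‖ = 1 → ‖y‖ = 1 → ∀ ε : ℝ, 0 < ε →
    ∃ f : StrongDual ℝ X, ‖f‖ = 1 ∧ x ∈ ballSlice f ε ∧
      Metric.infDist y (absConvexHull ℝ (ballSlice f ε)) < ε

/-- `E` contains an isomorphic copy of `F`: some linear subspace of `E`, with the norm of `E`, is
linearly homeomorphic to `F`. (When `F` is complete such a subspace is automatically closed.) -/
def ContainsIsomorphicCopy (E F : Type*) [NormedAddCommGroup E] [NormedSpace ℝ E]
    [NormedAddCommGroup F] [NormedSpace ℝ F] : Prop :=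
  ∃ M : Submodule ℝ E, Nonempty (F ≃L[ℝ] M)

/-! Lushness can be stated without functionals, so it passes to a separable closed
infinite-dimensional subspace `E`. A perturbation argument along a dense sequence then gives, for
each nonzero `x` in `E`, a spear functional not vanishing at `x`; since spears separate points, `E*`
contains infinitely many of them.

For distinct spears `g n`, the functionals in the unit ball of `E**` with modulus one at every `g n`
form a boundary for `E*`, on which each `g n` is a sign function. Rosenthal's dichotomy applies to
these signs. An independent subsequence is isometrically an `ℓ₁`-basis. Along a convergent
subsequence, consecutive differences vanish eventually at each boundary point, and Fonf's theorem
yields a weakly unconditionally Cauchy sequence bounded away from zero. In a dual space its signed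
series converge pointwise, which embeds the independent signs of `ℓ∞`, again an `ℓ₁`-sequence.
Hahn–Banach extensions carry the sequence from `E*` to `X*`. -/

/-! ### ℓ₁-sequences -/

/-- A bounded sequence that dominates the `ℓ₁`-norm of its coefficients. -/
def HasEllOneSequence (Y : Type*) [NormedAddCommGroup Y] [NormedSpace ℝ Y] : Prop :=
  ∃ h : ℕ → Y, (∃ C : ℝ, ∀ n, ‖h n‖ ≤ C) ∧ ∃ δ : ℝ, 0 < δ ∧
    ∀ (s : Finset ℕ) (c : ℕ → ℝ), δ * ∑ i ∈ s, |c i| ≤ ‖∑ i ∈ s, c i • h i‖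

theorem HasEllOneSequence.containsIsomorphicCopy {Y : Type*} [NormedAddCommGroup Y]
    [NormedSpace ℝ Y] [CompleteSpace Y] (hY : HasEllOneSequence Y) :
    ContainsIsomorphicCopy Y (lp (fun _ : ℕ => ℝ) 1) := by
  obtain ⟨h, ⟨C, hC⟩, δ, hδ, hlow⟩ := hY
  have habs : ∀ c : lp (fun _ : ℕ => ℝ) 1, HasSum (fun i => |c i|) ‖c‖ := by
    intro c
    have := lp.hasSum_norm (p := 1) (by norm_num) c
    simpa using this
  have hsum : ∀ c : lp (fun _ : ℕ => ℝ) 1, Summable (fun i => c i • h i) := by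
    intro c
    refine Summable.of_norm_bounded (g := fun i => |c i| * C) ((habs c).summable.mul_right C) ?_
    intro i
    rw [norm_smul, Real.norm_eq_abs]
    exact mul_le_mul_of_nonneg_left (hC i) (abs_nonneg _)
  let T : lp (fun _ : ℕ => ℝ) 1 →ₗ[ℝ] Y :=
    { toFun := fun c => ∑' i, c i • h i
      map_add' := fun c d => by
        rw [← (hsum c).tsum_add (hsum d)]
        exact tsum_congr fun i => by simp [add_smul]
      map_smul' := fun r c => by
        rw [RingHom.id_apply, ← (hsum c).tsum_const_smul]
        exact tsum_congr fun i => by simp [mul_smul] }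
  have hT : ∀ c, HasSum (fun i => c i • h i) (T c) := fun c => (hsum c).hasSum
  have hup : ∀ c, ‖T c‖ ≤ C * ‖c‖ := by
    intro c
    refine tsum_of_norm_bounded (g := fun i => C * |c i|) ((habs c).mul_left C) ?_
    intro i
    rw [norm_smul, Real.norm_eq_abs, mul_comm]
    exact mul_le_mul_of_nonneg_right (hC i) (abs_nonneg _)
  have hdown : ∀ c, δ * ‖c‖ ≤ ‖T c‖ := fun c =>
    le_of_tendsto_of_tendsto' ((habs c).mul_left δ) (hT c).norm fun s => by
      rw [← Finset.mul_sum]; exact hlow s _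
  have hinj : Function.Injective T := by
    rw [injective_iff_map_eq_zero]
    intro c hc
    have h1 := hdown c
    rw [hc, norm_zero] at h1
    have h2 : ‖c‖ ≤ 0 := by
      by_contra hlt
      push Not at hlt
      nlinarith
    exact norm_le_zero_iff.1 h2
  refine ⟨LinearMap.range T, ⟨(LinearEquiv.ofInjective T hinj).toContinuousLinearEquivOfBounds
    C δ⁻¹ ?_ ?_⟩⟩
  · intro c
    exact hup c
  · intro y
    obtain ⟨c, rfl⟩ := (LinearEquiv.ofInjective T hinj).surjective y
    rw [LinearEquiv.symm_apply_apply]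
    have := hdown c
    rw [inv_mul_eq_div, le_div_iff₀ hδ, mul_comm]
    exact this

/-- Extend each functional by Hahn–Banach with equal norm; restricting a combination back to `E`
cannot increase its norm, so the lower estimate survives. -/
theorem HasEllOneSequence.of_dual_submodule {X : Type*} [NormedAddCommGroup X] [NormedSpace ℝ X]
    (E : Submodule ℝ X) (hE : HasEllOneSequence (StrongDual ℝ E)) :
    HasEllOneSequence (StrongDual ℝ X) := by
  obtain ⟨h, ⟨C, hC⟩, δ, hδ, hlow⟩ := hE
  choose H hH hHn using fun n => exists_extension_norm_eq E (h n)
  refine ⟨H, ⟨C, fun n => (hHn n).trans_le (hC n)⟩, δ, hδ, fun s c => (hlow s c).trans ?_⟩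
  refine ContinuousLinearMap.opNorm_le_bound _ (norm_nonneg _) fun x => ?_
  have : (∑ i ∈ s, c i • h i) x = (∑ i ∈ s, c i • H i) (x : X) := by
    simp [hH]
  rw [this]
  exact ContinuousLinearMap.le_opNorm _ _

/-! ### Weakly unconditionally Cauchy sequences in dual spaces -/

/-- Weakly unconditionally Cauchy sequences, expressed through their finite subsums. -/
def BoundedSubsums {Y : Type*} [NormedAddCommGroup Y] (z : ℕ → Y) : Prop :=
  ∃ C : ℝ, ∀ P : Finset ℕ, ‖∑ i ∈ P, z i‖ ≤ C

/-- Splitting the indices by the sign of `z i x` turns the absolute sum into two subsums evaluated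
at `x`. The extra `1` in the constant only ensures positivity. -/
theorem BoundedSubsums.sum_abs_le {E : Type*} [NormedAddCommGroup E] [NormedSpace ℝ E]
    {z : ℕ → StrongDual ℝ E} (hz : BoundedSubsums z) :
    ∃ C : ℝ, 0 < C ∧ ∀ (x : E) (P : Finset ℕ), ∑ i ∈ P, |z i x| ≤ C * ‖x‖ := by
  obtain ⟨C, hC⟩ := hz
  have hC0 : 0 ≤ C := (norm_nonneg _).trans (hC ∅)
  refine ⟨2 * C + 1, by linarith, fun x P => ?_⟩
  have key : ∀ Q : Finset ℕ, |∑ i ∈ Q, z i x| ≤ C * ‖x‖ := by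
    intro Q
    have h1 := (∑ i ∈ Q, z i).le_opNorm x
    rw [sum_apply, Real.norm_eq_abs] at h1
    exact h1.trans (mul_le_mul_of_nonneg_right (hC Q) (norm_nonneg _))
  rw [← Finset.sum_filter_add_sum_filter_not P (fun i => 0 ≤ z i x)]
  have h1 : ∑ i ∈ P with 0 ≤ z i x, |z i x| ≤ C * ‖x‖ := by
    rw [Finset.sum_congr rfl (fun i hi => abs_of_nonneg (Finset.mem_filter.1 hi).2)]
    exact (le_abs_self _).trans (key _)
  have h2 : ∑ i ∈ P with ¬ 0 ≤ z i x, |z i x| ≤ C * ‖x‖ := by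
    rw [Finset.sum_congr rfl
      (fun i hi => abs_of_neg (not_le.1 (Finset.mem_filter.1 hi).2)), Finset.sum_neg_distrib]
    exact (neg_le_abs _).trans (key _)
  nlinarith [norm_nonneg x]

/-- A subsequence form of Rosenthal's disjointification lemma. -/
theorem exists_almost_biorthogonal_subsequence (m : ℕ → ℕ → ℝ) {C η : ℝ} (hη : 0 < η)
    (hm : ∀ (j : ℕ) (P : Finset ℕ), ∑ i ∈ P, |m i j| ≤ C) :
    ∃ φ : ℕ → ℕ, StrictMono φ ∧
      ∀ (n : ℕ) (P : Finset ℕ), n ∉ P → ∑ k ∈ P, |m (φ k) (φ n)| ≤ 3 * η := by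
  have hmem : ∀ i j, m i j ∈ Set.Icc (-C) C := fun i j => by
    have := hm j {i}
    rw [Finset.sum_singleton] at this
    exact abs_le.1 this
  -- Limits along one nonprincipal ultrafilter serve all rows at once and avoid a diagonal
  -- extraction.
  have hlim : ∀ i, ∃ l : ℝ, Filter.Tendsto (m i) (Filter.hyperfilter ℕ : Filter ℕ) (nhds l) := by
    intro i
    obtain ⟨l, -, hl⟩ := (isCompact_Icc (a := -C) (b := C)).ultrafilter_le_nhds
      ((Filter.hyperfilter ℕ).map (m i)) (by
        rw [Filter.le_principal_iff, Ultrafilter.mem_coe, Ultrafilter.mem_map]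
        exact Filter.univ_mem' (hmem i))
    exact ⟨l, hl⟩
  choose l hl using hlim
  have hls : Summable (fun i => |l i|) := by
    refine summable_of_sum_le (c := C) (fun i => abs_nonneg _) fun P => ?_
    exact le_of_tendsto (tendsto_finsetSum P fun i _ => (hl i).abs)
      (Filter.Eventually.of_forall fun j => hm j P)
  obtain ⟨s, hs⟩ := summable_iff_vanishing_norm.1 hls η hη
  obtain ⟨N, hN⟩ := s.exists_nat_subset_range
  have hstail : ∀ P : Finset ℕ, (∀ i ∈ P, N ≤ i) → ∑ i ∈ P, |l i| ≤ η := by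
    intro P hP
    refine (le_abs_self _).trans (hs P ?_).le
    rw [Finset.disjoint_left]
    intro i hi his
    have := Finset.mem_range.1 (hN his)
    have := hP i hi
    omega
  have htail : ∀ j, ∃ K, ∀ P : Finset ℕ, (∀ i ∈ P, K ≤ i) → ∑ i ∈ P, |m i j| ≤ η := by
    intro j
    have hsj : Summable (fun i => |m i j|) :=
      summable_of_sum_le (c := C) (fun i => abs_nonneg _) (hm j)
    obtain ⟨s, hs⟩ := summable_iff_vanishing_norm.1 hsj η hη
    obtain ⟨K, hK⟩ := s.exists_nat_subset_range
    refine ⟨K, fun P hP => (le_abs_self _).trans (hs P ?_).le⟩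
    rw [Finset.disjoint_left]
    intro i hi his
    have := Finset.mem_range.1 (hK his)
    have := hP i hi
    omega
  choose K hK using htail
  -- The bound `3 * η` has three sources: closeness of earlier rows to their limits, the tail of the
  -- limits (hence the start at `N`), and the column tail beyond `K p`.
  have hstep : ∀ p, ∃ j, p < j ∧ K p ≤ j ∧ ∑ i ∈ Finset.range (p + 1), |m i j - l i| ≤ η := by
    intro p
    have h1 : Filter.Tendsto (fun j => ∑ i ∈ Finset.range (p + 1), |m i j - l i|)
        (Filter.hyperfilter ℕ : Filter ℕ) (nhds (∑ i ∈ Finset.range (p + 1), |l i - l i|)) :=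
      tendsto_finsetSum _ fun i _ => ((hl i).sub_const (l i)).abs
    have h2 : ∀ᶠ j in (Filter.hyperfilter ℕ : Filter ℕ),
        ∑ i ∈ Finset.range (p + 1), |m i j - l i| < η :=
      h1.eventually_lt_const (by simpa using hη)
    have h3 : ∀ᶠ j in (Filter.hyperfilter ℕ : Filter ℕ), p + 1 + K p ≤ j := by
      refine Filter.Tendsto.eventually ?_ (Filter.eventually_ge_atTop (p + 1 + K p))
      rw [← Nat.cofinite_eq_atTop]
      exact Filter.hyperfilter_le_cofinite
    obtain ⟨j, hj2, hj3⟩ := (h2.and h3).exists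
    exact ⟨j, by omega, by omega, hj2.le⟩
  choose next hnext1 hnext2 hnext3 using hstep
  let φ : ℕ → ℕ := fun n => Nat.rec N (fun _ p => next p) n
  have hφ : ∀ n, φ (n + 1) = next (φ n) := fun n => rfl
  have hmono : StrictMono φ := strictMono_nat_of_lt_succ fun n => by
    rw [hφ]; exact hnext1 _
  have hφN : ∀ n, N ≤ φ n := fun n => hmono.monotone (Nat.zero_le n)
  refine ⟨φ, hmono, fun n P hP => ?_⟩
  have hmap : ∀ (Q : Finset ℕ) (f : ℕ → ℝ), ∑ k ∈ Q, f (φ k) = ∑ i ∈ Q.image φ, f i := by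
    intro Q f
    rw [Finset.sum_image (fun a _ b _ hab => hmono.injective hab)]
  rw [← Finset.sum_filter_add_sum_filter_not P (fun k => k < n)]
  have h1 : ∑ k ∈ P with k < n, |m (φ k) (φ n)| ≤ 2 * η := by
    have hle : ∑ k ∈ P with k < n, |m (φ k) (φ n)| ≤
        ∑ k ∈ P with k < n, |m (φ k) (φ n) - l (φ k)| + ∑ k ∈ P with k < n, |l (φ k)| := by
      rw [← Finset.sum_add_distrib]
      refine Finset.sum_le_sum fun k _ => ?_
      have := abs_add_le (m (φ k) (φ n) - l (φ k)) (l (φ k))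
      rwa [sub_add_cancel] at this
    have h2 : ∑ k ∈ P with k < n, |l (φ k)| ≤ η := by
      rw [hmap _ fun i => |l i|]
      refine hstail _ fun i hi => ?_
      obtain ⟨k, -, rfl⟩ := Finset.mem_image.1 hi
      exact hφN k
    have h3 : ∑ k ∈ P with k < n, |m (φ k) (φ n) - l (φ k)| ≤ η := by
      rcases n with _ | n
      · simpa using hη.le
      · rw [hmap _ fun i => |m i (φ (n + 1)) - l i|]
        refine (Finset.sum_le_sum_of_subset_of_nonneg ?_ fun i _ _ => abs_nonneg _).trans
          (hnext3 (φ n))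
        intro i hi
        obtain ⟨k, hk, rfl⟩ := Finset.mem_image.1 hi
        have := (Finset.mem_filter.1 hk).2
        rw [Finset.mem_range]
        exact Nat.lt_succ_of_le (hmono.monotone (by omega))
    linarith
  have h4 : ∑ k ∈ P with ¬ k < n, |m (φ k) (φ n)| ≤ η := by
    rw [hmap _ fun i => |m i (φ n)|]
    refine hK _ _ fun i hi => ?_
    obtain ⟨k, hk, rfl⟩ := Finset.mem_image.1 hi
    have hk1 := (Finset.mem_filter.1 hk).1
    have hk2 := (Finset.mem_filter.1 hk).2
    have hne : k ≠ n := fun h => hP (h ▸ hk1)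
    exact (hnext2 (φ n)).trans (hmono.monotone (by omega : n + 1 ≤ k))
  linarith

/-- Series `∑ ± z (φ k)` converge pointwise to bounded functionals, so sign patterns of `ℓ∞` live in
the dual. Patterns realizing every finite choice of signs at some coordinate span `ℓ₁`. -/
theorem BoundedSubsums.hasEllOneSequence {E : Type*} [NormedAddCommGroup E] [NormedSpace ℝ E]
    {z : ℕ → StrongDual ℝ E} (hz : BoundedSubsums z) {ε : ℝ} (hε : 0 < ε)
    (hlow : ∀ n, ε ≤ ‖z n‖) : HasEllOneSequence (StrongDual ℝ E) := by
  obtain ⟨C, hC0, hC⟩ := hz.sum_abs_le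
  have hx : ∀ n, ∃ x : E, ‖x‖ ≤ 1 ∧ ε / 2 ≤ z n x := by
    intro n
    obtain ⟨x, hx1, hx2⟩ := (z n).exists_lt_apply_of_lt_opNorm
      (show ε / 2 < ‖z n‖ by linarith [hlow n])
    rw [Real.norm_eq_abs] at hx2
    rcases abs_cases (z n x) with ⟨h, -⟩ | ⟨h, -⟩
    · exact ⟨x, hx1.le, by linarith⟩
    · exact ⟨-x, by rw [norm_neg]; exact hx1.le, by rw [map_neg]; linarith⟩
  choose x hx1 hx2 using hx
  -- With `η = ε / 12` the off-diagonal part is at most `ε / 4`, half of the diagonal lower bound `ε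
  -- / 2`.
  obtain ⟨φ, hφ, hoff⟩ := exists_almost_biorthogonal_subsequence (fun i j => z i (x j))
    (C := C) (η := ε / 12) (by positivity)
    (fun j P => (hC (x j) P).trans (mul_le_of_le_one_right hC0.le (hx1 j)))
  let F : ℕ ≃ Finset ℕ := (Denumerable.eqv (Finset ℕ)).symm
  let r : ℕ → ℕ → ℝ := fun n k => if n ∈ F k then 1 else -1
  have hr : ∀ n k, |r n k| = 1 := fun n k => by
    by_cases h : n ∈ F k <;> simp [r, h]
  have hC' : ∀ (y : E) (P : Finset ℕ), ∑ k ∈ P, |z (φ k) y| ≤ C * ‖y‖ := by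
    intro y P
    have := hC y (P.image φ)
    rwa [Finset.sum_image (fun a _ b _ hab => hφ.injective hab)] at this
  have hsabs : ∀ (n : ℕ) (y : E), Summable (fun k => |r n k * z (φ k) y|) := by
    intro n y
    refine summable_of_sum_le (c := C * ‖y‖) (fun i => abs_nonneg _) fun P => ?_
    simpa [abs_mul, hr] using hC' y P
  have hs : ∀ (n : ℕ) (y : E), Summable (fun k => r n k * z (φ k) y) := fun n y =>
    (hsabs n y).of_abs
  let h : ℕ → StrongDual ℝ E := fun n =>
    LinearMap.mkContinuous
      { toFun := fun y => ∑' k, r n k * z (φ k) y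
        map_add' := fun y w => by
          rw [← (hs n y).tsum_add (hs n w)]
          exact tsum_congr fun k => by rw [map_add, mul_add]
        map_smul' := fun t y => by
          rw [RingHom.id_apply, smul_eq_mul, ← (hs n y).tsum_mul_left]
          exact tsum_congr fun k => by rw [map_smul, smul_eq_mul]; ring }
      C (fun y => by
        refine (le_of_tendsto (hs n y).hasSum.norm (Filter.Eventually.of_forall fun P => ?_) :)
        refine (norm_sum_le _ _).trans ?_
        simpa [abs_mul, hr] using hC' y P)
  have hh : ∀ n y, HasSum (fun k => r n k * z (φ k) y) (h n y) := fun n y => (hs n y).hasSum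
  refine ⟨h, ⟨C, fun n => LinearMap.mkContinuous_norm_le _ hC0.le _⟩, ε / 4, by positivity, ?_⟩
  intro s c
  -- Coordinate `j` carries exactly the signs of `c` on `s`, so there the combined coefficient is
  -- the full `ℓ₁`-norm.
  obtain ⟨j, hj⟩ := F.surjective (s.filter fun i => 0 ≤ c i)
  set A : ℝ := ∑ i ∈ s, |c i| with hA
  have hA0 : 0 ≤ A := Finset.sum_nonneg fun i _ => abs_nonneg _
  let R : ℕ → ℝ := fun k => ∑ i ∈ s, c i * r i k
  have hRj : R j = A := by
    refine Finset.sum_congr rfl fun i hi => ?_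
    by_cases hc : 0 ≤ c i
    · have : i ∈ F j := by rw [hj]; exact Finset.mem_filter.2 ⟨hi, hc⟩
      simp [r, this, abs_of_nonneg hc]
    · have : i ∉ F j := by rw [hj]; exact fun h => hc (Finset.mem_filter.1 h).2
      simp [r, this, abs_of_neg (not_le.1 hc)]
  have hRle : ∀ k, |R k| ≤ A := fun k => by
    refine (Finset.abs_sum_le_sum_abs _ _).trans (Finset.sum_le_sum fun i _ => ?_)
    rw [abs_mul, hr, mul_one]
  have hsumR : HasSum (fun k => R k * z (φ k) (x (φ j)))
      ((∑ i ∈ s, c i • h i) (x (φ j))) := by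
    have h1 := hasSum_sum (s := s) fun i _ => (hh i (x (φ j))).mul_left (c i)
    rw [sum_apply]
    have h2 : (fun k => R k * z (φ k) (x (φ j))) =
        fun k => ∑ i ∈ s, c i * (r i k * z (φ k) (x (φ j))) := by
      funext k
      rw [Finset.sum_mul]
      exact Finset.sum_congr rfl fun i _ => by ring
    rw [h2]
    exact h1
  have hval : A * (ε / 4) ≤ (∑ i ∈ s, c i • h i) (x (φ j)) := by
    refine ge_of_tendsto hsumR ?_
    filter_upwards [Filter.eventually_ge_atTop {j}] with P hP
    have hjP : j ∈ P := hP (Finset.mem_singleton_self j)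
    rw [← Finset.add_sum_erase P _ hjP, hRj]
    have h1 : |∑ k ∈ P.erase j, R k * z (φ k) (x (φ j))| ≤ A * (3 * (ε / 12)) := by
      refine (Finset.abs_sum_le_sum_abs _ _).trans ?_
      calc ∑ k ∈ P.erase j, |R k * z (φ k) (x (φ j))|
          ≤ ∑ k ∈ P.erase j, A * |z (φ k) (x (φ j))| := Finset.sum_le_sum fun k _ => by
            rw [abs_mul]; exact mul_le_mul_of_nonneg_right (hRle k) (abs_nonneg _)
        _ ≤ A * (3 * (ε / 12)) := by
            rw [← Finset.mul_sum]
            exact mul_le_mul_of_nonneg_left (hoff j _ (Finset.notMem_erase j P)) hA0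
    have h2 := mul_le_mul_of_nonneg_left (hx2 (φ j)) hA0
    have h3 := (abs_le.1 h1).1
    linarith
  calc ε / 4 * A ≤ (∑ i ∈ s, c i • h i) (x (φ j)) := by linarith
    _ ≤ ‖(∑ i ∈ s, c i • h i) (x (φ j))‖ := le_abs_self _
    _ ≤ ‖∑ i ∈ s, c i • h i‖ * ‖x (φ j)‖ := ContinuousLinearMap.le_opNorm _ _
    _ ≤ ‖∑ i ∈ s, c i • h i‖ := mul_le_of_le_one_right (norm_nonneg _) (hx1 _)

/-! ### Rosenthal's dichotomy for two-valued functions -/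

/-- The functions `g n`, `n ∈ M`, converge pointwise on `A`. -/
def ConvergesOn {T : Type*} (g : ℕ → T → Bool) (M : Set ℕ) (A : Set T) : Prop :=
  ∀ e ∈ A, ∃ b : Bool, ∃ N : ℕ, ∀ n ∈ M, N ≤ n → g n e = b

/-- No infinite subfamily of `g n`, `n ∈ M`, converges pointwise on `A`. -/
def NowhereConvergent {T : Type*} (g : ℕ → T → Bool) (M : Set ℕ) (A : Set T) : Prop :=
  ∀ N ⊆ M, N.Infinite → ¬ ConvergesOn g N A

theorem NowhereConvergent.nonempty {T : Type*} {g : ℕ → T → Bool} {M : Set ℕ} {A : Set T}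
    (h : NowhereConvergent g M A) (hM : M.Infinite) : A.Nonempty := by
  by_contra hA
  rw [Set.not_nonempty_iff_eq_empty] at hA
  subst hA
  exact h M subset_rfl hM fun e he => he.elim

/-- Finitely many sets on which nothing converges can be split simultaneously. -/
theorem NowhereConvergent.exists_split {T : Type*} {g : ℕ → T → Bool} {F : Set (Set T)}
    (hF : F.Finite) {M : Set ℕ} (hM : M.Infinite) (h : ∀ A ∈ F, NowhereConvergent g M A) :
    ∃ n ∈ M, ∃ M' ⊆ M, M'.Infinite ∧ (∀ m ∈ M', n < m) ∧
      ∀ A ∈ F, ∀ b : Bool, NowhereConvergent g M' (A ∩ {e | g n e = b}) := by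
  by_contra hcon
  -- If no split exists, every infinite `S` has an infinite subset converging on some half-cell cut
  -- by `g (sInf S)`.
  have hstep : ∀ S : {S : Set ℕ // S.Infinite ∧ S ⊆ M},
      ∃ (p : F × Bool) (S' : {S : Set ℕ // S.Infinite ∧ S ⊆ M}),
        S'.1 ⊆ S.1 ∧ (∀ m ∈ S'.1, sInf S.1 < m) ∧
        ConvergesOn g S'.1 (p.1.1 ∩ {e | g (sInf S.1) e = p.2}) := by
    rintro ⟨S, hS, hSM⟩
    by_contra hno
    refine hcon ⟨sInf S, hSM (Nat.sInf_mem hS.nonempty), S ∩ Set.Ioi (sInf S),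
      Set.inter_subset_left.trans hSM, ?_, fun m hm => hm.2, ?_⟩
    · have : S \ Set.Iic (sInf S) = S ∩ Set.Ioi (sInf S) := by
        ext m; simp
      rw [← this]
      exact hS.sdiff (Set.finite_Iic _)
    · intro A hA b N hN hNi hconv
      exact hno ⟨(⟨A, hA⟩, b),
        ⟨N, hNi, (hN.trans Set.inter_subset_left).trans hSM⟩, hN.trans Set.inter_subset_left,
        fun m hm => (hN hm).2, hconv⟩
  choose p next hsub hlt hconv using hstep
  let S : ℕ → {S : Set ℕ // S.Infinite ∧ S ⊆ M} := fun k =>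
    Nat.rec ⟨M, hM, subset_rfl⟩ (fun _ s => next s) k
  have hS : ∀ k, S (k + 1) = next (S k) := fun k => rfl
  have hanti : ∀ i j, i ≤ j → (S j).1 ⊆ (S i).1 := by
    intro i j hij
    induction j, hij using Nat.le_induction with
    | base => exact subset_rfl
    | succ j _ ih => exact (hS j ▸ hsub (S j)).trans ih
  let n : ℕ → ℕ := fun k => sInf (S k).1
  have hnmem : ∀ k, n k ∈ (S k).1 := fun k => Nat.sInf_mem (S k).2.1.nonempty
  have hnmono : StrictMono n := strictMono_nat_of_lt_succ fun k => by
    have := hnmem (k + 1)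
    rw [hS] at this
    exact hlt (S k) _ this
  have : Finite F := hF
  -- One pair `(A, b)` recurs infinitely often. Along its indices `g` converges on all of `A`: a
  -- point of `A` either takes the value `b` once, and later stages converge there, or always takes
  -- `!b`.
  obtain ⟨⟨⟨A, hA⟩, b⟩, hI⟩ := Finite.exists_infinite_fiber (fun k => p (S k))
  have hI' : ((fun k => p (S k)) ⁻¹' {(⟨A, hA⟩, b)}).Infinite := Set.infinite_coe_iff.1 hI
  refine h A hA (n '' ((fun k => p (S k)) ⁻¹' {(⟨A, hA⟩, b)})) ?_
    (hI'.image hnmono.injective.injOn) ?_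
  · rintro _ ⟨k, -, rfl⟩
    exact (S k).2.2 (hnmem k)
  · intro e he
    by_cases hex : ∃ k, p (S k) = (⟨A, hA⟩, b) ∧ g (n k) e = b
    · obtain ⟨k, hk, hke⟩ := hex
      have h1 := hconv (S k)
      rw [hk] at h1
      obtain ⟨b', N, hN⟩ := h1 e ⟨he, hke⟩
      refine ⟨b', max N (n k + 1), ?_⟩
      rintro _ ⟨j, -, rfl⟩ hj
      have hkj : k < j := hnmono.lt_iff_lt.1 (by omega)
      refine hN _ ?_ (by omega)
      rw [← hS]
      exact hanti (k + 1) j hkj (hnmem j)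
    · refine ⟨!b, 0, ?_⟩
      rintro _ ⟨k, hk, rfl⟩ -
      by_contra hne
      exact hex ⟨k, hk, by simpa using hne⟩

/-- Rosenthal's dichotomy for sequences of two-valued functions. -/
theorem exists_convergent_or_independent_subsequence {T : Type*} (g : ℕ → T → Bool) :
    (∃ φ : ℕ → ℕ, StrictMono φ ∧ ∀ e, ∃ b, ∃ N, ∀ n, N ≤ n → g (φ n) e = b) ∨
    (∃ φ : ℕ → ℕ, StrictMono φ ∧ ∀ (σ : ℕ → Bool) (k : ℕ), ∃ e, ∀ i < k, g (φ i) e = σ i) := by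
  by_cases hconv : ∃ N : Set ℕ, N.Infinite ∧ ConvergesOn g N Set.univ
  · obtain ⟨N, hN, hc⟩ := hconv
    left
    refine ⟨Nat.nth (· ∈ N), Nat.nth_strictMono hN, fun e => ?_⟩
    obtain ⟨b, K, hK⟩ := hc e (Set.mem_univ e)
    exact ⟨b, K, fun n hn => hK _ (Nat.nth_mem_of_infinite hN n)
      (hn.trans (Nat.nth_strictMono hN).le_apply)⟩
  right
  -- The family of cells always contains every sign pattern of the functions chosen so far; nowhere
  -- convergence keeps them all nonempty.
  let State := {s : Set (Set T) × Set ℕ //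
    s.1.Finite ∧ s.2.Infinite ∧ ∀ A ∈ s.1, NowhereConvergent g s.2 A}
  have hstep : ∀ s : State, ∃ (n : ℕ) (s' : State), n ∈ s.1.2 ∧ s'.1.2 ⊆ s.1.2 ∧
      (∀ m ∈ s'.1.2, n < m) ∧ ∀ A ∈ s.1.1, ∀ b : Bool, A ∩ {e | g n e = b} ∈ s'.1.1 := by
    rintro ⟨⟨F, M⟩, hF, hM, hFM⟩
    obtain ⟨n, hn, M', hM', hM'i, hlt, hsplit⟩ := NowhereConvergent.exists_split hF hM hFM
    refine ⟨n, ⟨⟨Set.image2 (fun A b => A ∩ {e | g n e = b}) F Set.univ, M'⟩,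
      hF.image2 _ Set.finite_univ, hM'i, ?_⟩, hn, hM', hlt, ?_⟩
    · rintro _ ⟨A, hA, b, -, rfl⟩
      exact hsplit A hA b
    · intro A hA b
      exact ⟨A, hA, b, Set.mem_univ b, rfl⟩
  choose n next hn hsub hlt hmem using hstep
  let S : ℕ → State := fun k => Nat.rec
    ⟨⟨{Set.univ}, Set.univ⟩, Set.finite_singleton _, Set.infinite_univ, fun A hA N _ hN hc => by
      rw [Set.mem_singleton_iff.1 hA] at hc
      exact hconv ⟨N, hN, hc⟩⟩ (fun _ s => next s) k
  have hS : ∀ k, S (k + 1) = next (S k) := fun k => rfl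
  refine ⟨fun k => n (S k), strictMono_nat_of_lt_succ fun k => ?_, fun σ k => ?_⟩
  · have := hn (S (k + 1))
    nth_rw 2 [hS] at this
    exact hlt _ _ this
  · have key : {e | ∀ i < k, g (n (S i)) e = σ i} ∈ (S k).1.1 := by
      induction k with
      | zero =>
        have : {e : T | ∀ i < 0, g (n (S i)) e = σ i} = Set.univ := by
          ext e; simp
        rw [this]
        exact Set.mem_singleton _
      | succ k ih =>
        have : {e | ∀ i < k + 1, g (n (S i)) e = σ i} =
            {e | ∀ i < k, g (n (S i)) e = σ i} ∩ {e | g (n (S k)) e = σ k} := by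
          ext e
          simp only [Set.mem_ofPred_eq, Set.mem_inter_iff, Nat.forall_lt_succ_right]
        rw [this, hS]
        exact hmem (S k) _ ih (σ k)
    exact ((S k).2.2.2 _ key).nonempty (S k).2.2.1

/-! ### Fonf's theorem by renorming -/

/-- The dual weight `1 + 1 / (1 + ∑ |e (d n)|)` used to renorm a space on whose boundary
the series `∑ d n` converges absolutely. -/
noncomputable def boundaryWeight {Y : Type*} [NormedAddCommGroup Y] [NormedSpace ℝ Y]
    (d : ℕ → Y) (e : StrongDual ℝ Y) : ℝ :=
  1 + 1 / (1 + ∑' n, |e (d n)|)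

theorem one_lt_boundaryWeight {Y : Type*} [NormedAddCommGroup Y] [NormedSpace ℝ Y]
    (d : ℕ → Y) (e : StrongDual ℝ Y) : 1 < boundaryWeight d e := by
  have : 0 ≤ ∑' n, |e (d n)| := tsum_nonneg fun _ => abs_nonneg _
  unfold boundaryWeight
  have : 0 < 1 / (1 + ∑' n, |e (d n)|) := by positivity
  linarith

theorem boundaryWeight_le_two {Y : Type*} [NormedAddCommGroup Y] [NormedSpace ℝ Y]
    (d : ℕ → Y) (e : StrongDual ℝ Y) : boundaryWeight d e ≤ 2 := by
  have : 0 ≤ ∑' n, |e (d n)| := tsum_nonneg fun _ => abs_nonneg _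
  unfold boundaryWeight
  have : 1 / (1 + ∑' n, |e (d n)|) ≤ 1 := by
    rw [div_le_one (by positivity)]; linarith
  linarith

/-- `q(y) ≤ r` for the renorming `q(y) = sup_{e ∈ T} w(e) |e y|`. -/
def RenormLE {Y : Type*} [NormedAddCommGroup Y] [NormedSpace ℝ Y]
    (T : Set (StrongDual ℝ Y)) (d : ℕ → Y) (y : Y) (r : ℝ) : Prop :=
  ∀ e ∈ T, boundaryWeight d e * |e y| ≤ r

theorem RenormLE.norm_le {Y : Type*} [NormedAddCommGroup Y] [NormedSpace ℝ Y]
    {T : Set (StrongDual ℝ Y)} {d : ℕ → Y} {y : Y} {r : ℝ} (h : RenormLE T d y r)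
    (hbd : ∀ y : Y, ∃ e ∈ T, e y = ‖y‖) : ‖y‖ ≤ r := by
  obtain ⟨e, he, hey⟩ := hbd y
  have h1 := h e he
  rw [hey, abs_norm] at h1
  have h2 := one_lt_boundaryWeight d e
  nlinarith [norm_nonneg y]

/-- Near each point the renorming depends only on the functionals `e` with
`∑ |e (d n)|` bounded by a fixed constant. -/
theorem exists_renormLE_add {Y : Type*} [NormedAddCommGroup Y] [NormedSpace ℝ Y]
    {T : Set (StrongDual ℝ Y)} {d : ℕ → Y} (hT : ∀ e ∈ T, ‖e‖ ≤ 1)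
    (hbd : ∀ y : Y, ∃ e ∈ T, e y = ‖y‖) (y : Y) :
    ∃ δ : ℝ, 0 < δ ∧ ∃ k : ℝ, ∀ u v : Y, ∀ r η : ℝ, ‖u - y‖ < δ → ‖v‖ < δ → 1 / 2 ≤ r → 0 ≤ η →
      RenormLE T d u r → (∀ e ∈ T, ∑' n, |e (d n)| ≤ k → |e v| ≤ η) →
      RenormLE T d (u + v) (r + 2 * η) := by
  have habs : ∀ e ∈ T, ∀ x : Y, |e x| ≤ ‖x‖ := fun e he x => by
    have := e.le_opNorm x
    rw [Real.norm_eq_abs] at this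
    exact this.trans (mul_le_of_le_one_left (norm_nonneg _) (hT e he))
  rcases eq_or_ne y 0 with rfl | hy
  · refine ⟨1 / 8, by norm_num, 0, fun u v r η hu hv hr hη _ _ e he => ?_⟩
    rw [sub_zero] at hu
    have h1 := (habs e he (u + v)).trans (norm_add_le u v)
    have h2 := boundaryWeight_le_two d e
    have h3 := one_lt_boundaryWeight d e
    nlinarith [abs_nonneg (e (u + v))]
  · obtain ⟨e₀, he₀, hey⟩ := hbd y
    set W := boundaryWeight d e₀ with hW
    have hW1 : 1 < W := one_lt_boundaryWeight d e₀
    have hW2 : W ≤ 2 := boundaryWeight_le_two d e₀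
    have hpos : 0 < ‖y‖ := norm_pos_iff.2 hy
    -- Functionals of weight at most `(1 + W) / 2` are dominated by `e₀` near `y`, the gap `(W - 1)
    -- / 2 * ‖y‖` absorbing the perturbations. Larger weight forces `∑ |e (d n)| ≤ 2 / (W - 1)`.
    refine ⟨(W - 1) * ‖y‖ / 16, by nlinarith, 2 / (W - 1), fun u v r η hu hv hr hη hur hv2 e he => ?_⟩
    have hw1 := one_lt_boundaryWeight d e
    have hw2 := boundaryWeight_le_two d e
    by_cases hle : boundaryWeight d e ≤ (1 + W) / 2
    · have h1 := (habs e he (u + v)).trans (norm_add_le u v)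
      have h2 := hur e₀ he₀
      rw [← hW] at h2
      have h3 : ‖y‖ - ‖u - y‖ ≤ |e₀ u| := by
        have h4 := habs e₀ he₀ (u - y)
        rw [map_sub, hey] at h4
        have h5 := (abs_le.1 h4).1
        have := le_abs_self (e₀ u)
        linarith
      have h6 : ‖u‖ ≤ ‖y‖ + ‖u - y‖ := by
        have := norm_add_le y (u - y)
        rwa [add_sub_cancel] at this
      have h7 : |e (u + v)| ≤ ‖y‖ + (W - 1) * ‖y‖ / 8 := by linarith
      have h8 : ‖y‖ - (W - 1) * ‖y‖ / 16 ≤ |e₀ u| := by linarith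
      have h9 : boundaryWeight d e * |e (u + v)| ≤ (1 + W) / 2 * (‖y‖ + (W - 1) * ‖y‖ / 8) :=
        mul_le_mul hle h7 (abs_nonneg _) (by linarith)
      have h10 : W * (‖y‖ - (W - 1) * ‖y‖ / 16) ≤ W * |e₀ u| :=
        mul_le_mul_of_nonneg_left h8 (by linarith)
      have h11 : (1 + W) / 2 * (‖y‖ + (W - 1) * ‖y‖ / 8) ≤ W * (‖y‖ - (W - 1) * ‖y‖ / 16) := by
        have : W * (‖y‖ - (W - 1) * ‖y‖ / 16) - (1 + W) / 2 * (‖y‖ + (W - 1) * ‖y‖ / 8) =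
            ‖y‖ * (W - 1) * (7 - 2 * W) / 16 := by ring
        have h12 : 0 ≤ ‖y‖ * (W - 1) * (7 - 2 * W) / 16 := by
          have : 0 ≤ W - 1 := by linarith
          have : 0 ≤ 7 - 2 * W := by linarith
          positivity
        linarith
      linarith
    · push Not at hle
      have hs0 : 0 ≤ ∑' n, |e (d n)| := tsum_nonneg fun _ => abs_nonneg _
      have hs : ∑' n, |e (d n)| ≤ 2 / (W - 1) := by
        unfold boundaryWeight at hle
        have h1 : (W - 1) / 2 < 1 / (1 + ∑' n, |e (d n)|) := by linarith
        rw [lt_div_iff₀ (by linarith)] at h1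
        rw [le_div_iff₀ (by linarith)]
        nlinarith
      have h1 := hv2 e he hs
      have h2 := hur e he
      have h3 : |e (u + v)| ≤ |e u| + |e v| := by rw [map_add]; exact abs_add_le _ _
      nlinarith [abs_nonneg (e v), abs_nonneg (e u)]

/-- A bounded set containing `0` has an element whose norm is within a factor two
of the largest possible. -/
theorem exists_mem_forall_norm_le_two_mul {Y : Type*} [NormedAddCommGroup Y] {S : Set Y}
    {C : ℝ} (h0 : (0 : Y) ∈ S) (hS : ∀ v ∈ S, ‖v‖ ≤ C) : ∃ w ∈ S, ∀ v ∈ S, ‖v‖ ≤ 2 * ‖w‖ := by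
  by_contra! hcon
  have hne : (norm '' S).Nonempty := ⟨_, Set.mem_image_of_mem _ h0⟩
  have hbdd : BddAbove (norm '' S) := ⟨C, by rintro _ ⟨v, hv, rfl⟩; exact hS v hv⟩
  obtain ⟨v₀, hv₀, hv₀'⟩ := hcon 0 h0
  rw [norm_zero, mul_zero] at hv₀'
  have hpos : 0 < sSup (norm '' S) := hv₀'.trans_le (le_csSup hbdd (Set.mem_image_of_mem _ hv₀))
  obtain ⟨_, ⟨w, hw, rfl⟩, hlt⟩ := exists_lt_of_lt_csSup hne (half_lt_self hpos)
  obtain ⟨v, hv, hv'⟩ := hcon w hw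
  have := le_csSup hbdd (Set.mem_image_of_mem norm hv)
  linarith

/-- A series with bounded but not unconditionally convergent subsums has a blocking
bounded away from zero. -/
theorem exists_boundedSubsums_of_not_summable {Y : Type*} [NormedAddCommGroup Y]
    [CompleteSpace Y] {y : ℕ → Y} (hy : BoundedSubsums y) (hns : ¬ Summable y) :
    ∃ (z : ℕ → Y) (ε : ℝ), 0 < ε ∧ BoundedSubsums z ∧ ∀ n, ε ≤ ‖z n‖ := by
  rw [summable_iff_vanishing_norm] at hns
  push Not at hns
  obtain ⟨ε, hε, hns⟩ := hns
  choose t htd htn using hns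
  -- `U n` collects the blocks chosen before stage `n`, so each new block is disjoint from them.
  let U : ℕ → Finset ℕ := fun n => Nat.rec ∅ (fun _ s => s ∪ t s) n
  have hU : ∀ n, U (n + 1) = U n ∪ t (U n) := fun n => rfl
  have hUm : Monotone U := monotone_nat_of_le_succ fun n => by
    rw [hU]; exact Finset.subset_union_left
  have hdisj : ∀ i j, i < j → Disjoint (t (U i)) (t (U j)) := fun i j hij => by
    have h1 : t (U i) ⊆ U j := by
      refine Finset.Subset.trans ?_ (hUm (Nat.succ_le_of_lt hij))
      rw [Nat.succ_eq_add_one, hU]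
      exact Finset.subset_union_right
    exact ((htd (U j)).mono_right h1).symm
  obtain ⟨C, hC⟩ := hy
  refine ⟨fun n => ∑ i ∈ t (U n), y i, ε, hε, ⟨C, fun P => ?_⟩, fun n => htn _⟩
  rw [← Finset.sum_biUnion]
  · exact hC _
  · intro i _ j _ hij
    rcases lt_or_gt_of_ne hij with h | h
    · exact hdisj i j h
    · exact (hdisj j i h).symm

/-- The subsums of a summable series form a totally bounded set. -/
theorem totallyBounded_subsums_of_summable {Y : Type*} [NormedAddCommGroup Y] [CompleteSpace Y]
    {y : ℕ → Y} (hy : Summable y) :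
    TotallyBounded (Set.range fun P : Finset ℕ => ∑ i ∈ P, y i) := by
  rw [Metric.totallyBounded_iff]
  intro ε hε
  obtain ⟨s, hs⟩ := summable_iff_vanishing_norm.1 hy ε hε
  refine ⟨(fun P : Finset ℕ => ∑ i ∈ P, y i) '' (s.powerset : Set (Finset ℕ)),
    (Finset.finite_toSet _).image _, ?_⟩
  rintro _ ⟨P, rfl⟩
  refine Set.mem_iUnion₂.2 ⟨_, ⟨P ∩ s, by simp, rfl⟩, ?_⟩
  rw [Metric.mem_ball, dist_eq_norm]
  have h1 : ∑ i ∈ P, y i - ∑ i ∈ P ∩ s, y i = ∑ i ∈ P \ s, y i := by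
    rw [sub_eq_iff_eq_add, add_comm, Finset.sum_inter_add_sum_sdiff]
  simp only [h1]
  exact hs _ Finset.sdiff_disjoint

/-- Fonf's theorem: if `∑ |e (d n)| < ∞` for all `e` in a boundary and `d` is bounded away from
zero, then the space contains a weakly unconditionally Cauchy sequence bounded away from zero. -/
theorem exists_boundedSubsums_of_summable_on_boundary {Y : Type*} [NormedAddCommGroup Y]
    [NormedSpace ℝ Y] [CompleteSpace Y] {T : Set (StrongDual ℝ Y)} {d : ℕ → Y}
    (hT : ∀ e ∈ T, ‖e‖ ≤ 1) (hbd : ∀ y : Y, ∃ e ∈ T, e y = ‖y‖)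
    (hsum : ∀ e ∈ T, Summable fun n => |e (d n)|) {ε₀ : ℝ} (hε₀ : 0 < ε₀)
    (hd : ∀ n, ε₀ ≤ ‖d n‖) :
    ∃ (z : ℕ → Y) (ε : ℝ), 0 < ε ∧ BoundedSubsums z ∧ ∀ n, ε ≤ ‖z n‖ := by
  -- If the functionals with `∑ |e (d n)| ≤ k` uniformly detect a sphere, they bound the subsums of
  -- `d` itself. Otherwise there are vectors of any prescribed norm nearly invisible to them, from
  -- which `y` is built.
  by_cases hsmall : ∃ k δ η : ℝ, 0 < δ ∧ 0 < η ∧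
      ∀ v : Y, ‖v‖ = δ → ∃ e ∈ T, ∑' n, |e (d n)| ≤ k ∧ η < |e v|
  · obtain ⟨k, δ, η, hδ, hη, hv⟩ := hsmall
    refine ⟨d, ε₀, hε₀, ⟨|k| * δ / η, fun P => ?_⟩, hd⟩
    set x := ∑ i ∈ P, d i with hx
    rcases eq_or_ne x 0 with h0 | h0
    · rw [h0, norm_zero]; positivity
    have hxp : 0 < ‖x‖ := norm_pos_iff.2 h0
    obtain ⟨e, he, hek, hlt⟩ := hv ((δ / ‖x‖) • x) (by
      rw [norm_smul, Real.norm_eq_abs, abs_of_pos (by positivity)]; field_simp)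
    have h1 : |e x| ≤ k := by
      rw [hx, map_sum]
      exact (Finset.abs_sum_le_sum_abs _ _).trans
        (((hsum e he).sum_le_tsum P fun i _ => abs_nonneg _).trans hek)
    rw [map_smul, smul_eq_mul, abs_mul, abs_of_pos (by positivity : 0 < δ / ‖x‖)] at hlt
    rw [le_div_iff₀ hη]
    have h2 : η * ‖x‖ < δ * |e x| := by
      have := mul_lt_mul_of_pos_right hlt hxp
      rwa [div_mul_eq_mul_div, div_mul_cancel₀ _ hxp.ne'] at this
    have h3 : δ * |e x| ≤ δ * |k| := mul_le_mul_of_nonneg_left (h1.trans (le_abs_self k)) hδ.le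
    linarith
  push Not at hsmall
  let r : ℕ → ℝ := fun n => 1 - (1 / 2) ^ (n + 1)
  have hrstep : ∀ n, r (n + 1) = r n + (1 / 2) ^ (n + 2) := fun n => by
    simp only [r]; ring
  have hr1 : ∀ n, r n ≤ 1 := fun n => by
    have : (0 : ℝ) ≤ (1 / 2) ^ (n + 1) := by positivity
    simp only [r]; linarith
  have hrmono : ∀ n, r n ≤ r (n + 1) := fun n => by
    rw [hrstep]
    have : (0 : ℝ) ≤ (1 / 2) ^ (n + 2) := by positivity
    linarith
  have hrhalf : ∀ n, 1 / 2 ≤ r n := fun n => by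
    have : ((1 : ℝ) / 2) ^ (n + 1) ≤ (1 / 2) ^ 1 :=
      pow_le_pow_of_le_one (by norm_num) (by norm_num) (by omega)
    simp only [r]; linarith
  -- Admissible increments keep every subsum within the next renormed radius; each `y n` is taken of
  -- nearly maximal norm among them.
  let avail : Set Y → ℕ → Set Y := fun C n => {v | ∀ c ∈ C, RenormLE T d (c + v) (r (n + 1))}
  have hpick : ∀ (C : Set Y) (n : ℕ), ∃ w : Y, (0 : Y) ∈ C → (∀ c ∈ C, RenormLE T d c (r n)) →
      w ∈ avail C n ∧ ∀ v ∈ avail C n, ‖v‖ ≤ 2 * ‖w‖ := by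
    intro C n
    by_cases hC : (0 : Y) ∈ C ∧ ∀ c ∈ C, RenormLE T d c (r n)
    · obtain ⟨w, hw, hw'⟩ := exists_mem_forall_norm_le_two_mul (S := avail C n) (C := 1)
        (fun c hc e he => by rw [add_zero]; exact (hC.2 c hc e he).trans (hrmono n))
        (fun v hv => by
          have := (hv 0 hC.1).norm_le hbd
          rw [zero_add] at this
          exact this.trans (hr1 _))
      exact ⟨w, fun _ _ => ⟨hw, hw'⟩⟩
    · exact ⟨0, fun h1 h2 => (hC ⟨h1, h2⟩).elim⟩
  choose pick hpick using hpick
  let C : ℕ → Set Y := fun n => Nat.rec {0} (fun n C => C ∪ (fun c => c + pick C n) '' C) n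
  have hCs : ∀ n, C (n + 1) = C n ∪ (fun c => c + pick (C n) n) '' C n := fun n => rfl
  let y : ℕ → Y := fun n => pick (C n) n
  have hC : ∀ n, (0 : Y) ∈ C n ∧ ∀ c ∈ C n, RenormLE T d c (r n) := by
    intro n
    induction n with
    | zero =>
      refine ⟨Set.mem_singleton _, fun c hc e _ => ?_⟩
      rw [Set.mem_singleton_iff.1 hc, map_zero, abs_zero, mul_zero]
      exact (by norm_num : (0 : ℝ) ≤ 1 / 2).trans (hrhalf 0)
    | succ n ih =>
      rw [hCs]
      refine ⟨Or.inl ih.1, ?_⟩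
      rintro c (hc | ⟨c, hc, rfl⟩)
      · exact fun e he => (ih.2 c hc e he).trans (hrmono n)
      · exact (hpick (C n) n ih.1 ih.2).1 c hc
  have hmem : ∀ (n : ℕ) (P : Finset ℕ), P ⊆ Finset.range n → ∑ i ∈ P, y i ∈ C n := by
    intro n
    induction n with
    | zero =>
      intro P hP
      rw [Finset.range_zero, Finset.subset_empty] at hP
      subst hP
      exact Set.mem_singleton _
    | succ n ih =>
      intro P hP
      have hP' : P.erase n ⊆ Finset.range n := by
        intro i hi
        have h1 := Finset.mem_range.1 (hP (Finset.mem_of_mem_erase hi))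
        have h2 := Finset.ne_of_mem_erase hi
        exact Finset.mem_range.2 (by omega)
      rw [hCs]
      by_cases hn : n ∈ P
      · right
        exact ⟨_, ih _ hP', Finset.sum_erase_add _ _ hn⟩
      · left
        rw [Finset.erase_eq_of_notMem hn] at hP'
        exact ih _ hP'
  have hmem' : ∀ n, ∀ c ∈ C n, c ∈ Set.range fun P : Finset ℕ => ∑ i ∈ P, y i := by
    have : ∀ n, ∀ c ∈ C n, ∃ P : Finset ℕ, P ⊆ Finset.range n ∧ ∑ i ∈ P, y i = c := by
      intro n
      induction n with
      | zero =>
        intro c hc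
        exact ⟨∅, Finset.empty_subset _, (Set.mem_singleton_iff.1 hc).symm⟩
      | succ n ih =>
        have hsub : Finset.range n ⊆ Finset.range (n + 1) :=
          Finset.range_subset_range.2 (Nat.le_succ n)
        rintro c (hc | ⟨c, hc, rfl⟩)
        · obtain ⟨P, hP, rfl⟩ := ih c hc
          exact ⟨P, hP.trans hsub, rfl⟩
        · obtain ⟨P, hP, rfl⟩ := ih c hc
          have hn : n ∉ P := fun h => Finset.notMem_range_self (hP h)
          refine ⟨insert n P, ?_, ?_⟩
          · exact Finset.insert_subset (Finset.self_mem_range_succ n) (hP.trans hsub)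
          · rw [Finset.sum_insert hn, add_comm]
    intro n c hc
    obtain ⟨P, -, rfl⟩ := this n c hc
    exact ⟨P, rfl⟩
  have hyb : BoundedSubsums y := ⟨1, fun P => by
    obtain ⟨n, hn⟩ := P.exists_nat_subset_range
    exact (((hC n).2 _ (hmem n P hn)).norm_le hbd).trans (hr1 n)⟩
  -- Were `y` summable, its subsums would be relatively compact and the local constants `δ`, `k`
  -- uniform.
  refine exists_boundedSubsums_of_not_summable hyb fun hys => ?_
  have hcpt : IsCompact (closure (Set.range fun P : Finset ℕ => ∑ i ∈ P, y i)) :=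
    (totallyBounded_subsums_of_summable hys).closure.isCompact_of_isClosed isClosed_closure
  have hunif : ∃ δ : ℝ, 0 < δ ∧ ∃ k : ℝ,
      ∀ u ∈ closure (Set.range fun P : Finset ℕ => ∑ i ∈ P, y i), ∀ v : Y, ∀ r η : ℝ,
      ‖v‖ < δ → 1 / 2 ≤ r → 0 ≤ η →
      RenormLE T d u r → (∀ e ∈ T, ∑' n, |e (d n)| ≤ k → |e v| ≤ η) →
      RenormLE T d (u + v) (r + 2 * η) := by
    refine hcpt.induction_on (p := fun S => ∃ δ : ℝ, 0 < δ ∧ ∃ k : ℝ,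
      ∀ u ∈ S, ∀ v : Y, ∀ r η : ℝ, ‖v‖ < δ → 1 / 2 ≤ r → 0 ≤ η →
      RenormLE T d u r → (∀ e ∈ T, ∑' n, |e (d n)| ≤ k → |e v| ≤ η) →
      RenormLE T d (u + v) (r + 2 * η)) ?_ ?_ ?_ ?_
    · exact ⟨1, one_pos, 0, fun u hu => hu.elim⟩
    · rintro s t hst ⟨δ, hδ, k, h⟩
      exact ⟨δ, hδ, k, fun u hu => h u (hst hu)⟩
    · rintro s t ⟨δ, hδ, k, h⟩ ⟨δ', hδ', k', h'⟩
      refine ⟨min δ δ', lt_min hδ hδ', max k k', ?_⟩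
      rintro u (hu | hu) v r η hv hr hη hur he
      · exact h u hu v r η (hv.trans_le (min_le_left _ _)) hr hη hur
          fun e heT hek => he e heT (hek.trans (le_max_left _ _))
      · exact h' u hu v r η (hv.trans_le (min_le_right _ _)) hr hη hur
          fun e heT hek => he e heT (hek.trans (le_max_right _ _))
    · intro x _
      obtain ⟨δ, hδ, k, h⟩ := exists_renormLE_add (d := d) hT hbd x
      refine ⟨Metric.ball x δ, mem_nhdsWithin_of_mem_nhds (Metric.ball_mem_nhds x hδ),
        δ, hδ, k, fun u hu v r η => h u v r η ?_⟩
      rwa [← dist_eq_norm]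
  obtain ⟨δ, hδ, k, hunif⟩ := hunif
  have hlow : ∀ n, δ / 4 ≤ ‖y n‖ := by
    intro n
    -- Since `r (n + 1) - r n = 2 * (1 / 2) ^ (n + 3)`, this invisible vector of norm `δ / 2` is
    -- admissible at every stage; near-maximality keeps `y n` away from zero.
    obtain ⟨v, hv, hev⟩ := hsmall k (δ / 2) ((1 / 2) ^ (n + 3)) (by linarith) (by positivity)
    have hav : v ∈ avail (C n) n := by
      intro c hc
      have := hunif c (subset_closure (hmem' n c hc)) v (r n) ((1 / 2) ^ (n + 3))
        (by linarith) (hrhalf n) (by positivity) ((hC n).2 c hc) hev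
      rw [hrstep]
      convert this using 2
      ring
    have := (hpick (C n) n (hC n).1 (hC n).2).2 v hav
    rw [hv] at this
    change δ / 4 ≤ ‖pick (C n) n‖
    linarith
  have h0 := hys.tendsto_atTop_zero.norm
  rw [norm_zero] at h0
  have := ge_of_tendsto' h0 hlow
  linarith

/-! ### Lushness without functionals and separable reduction -/

/-- A functional-free form of lushness, which passes to suitable separable subspaces. -/
def SplitsLushly (X : Type*) [NormedAddCommGroup X] [NormedSpace ℝ X] : Prop :=
  ∀ x y : X, ∀ ε : ℝ, 0 < ε → ∃ a b : X, ‖a‖ + ‖b‖ ≤ 1 ∧ ‖y - ‖y‖ • (a - b)‖ < ε ∧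
    ‖x‖ + 1 - ε < ‖x + (a + b)‖

/-- The target set contains the slice and is convex and balanced: `s` and `t` record the masses of
positive and negative coefficients, and a negative scalar swaps the two parts. -/
theorem exists_sub_of_mem_absConvexHull_ballSlice {X : Type*} [NormedAddCommGroup X]
    [NormedSpace ℝ X] {f : StrongDual ℝ X} {ε : ℝ} {p : X}
    (hp : p ∈ absConvexHull ℝ (ballSlice f ε)) :
    ∃ (a b : X) (s t : ℝ), p = a - b ∧ ‖a‖ ≤ s ∧ ‖b‖ ≤ t ∧ s + t ≤ 1 ∧
      (1 - ε) * s ≤ f a ∧ (1 - ε) * t ≤ f b := by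
  refine absConvexHull_min (t := {p | ∃ (a b : X) (s t : ℝ), p = a - b ∧ ‖a‖ ≤ s ∧ ‖b‖ ≤ t ∧
    s + t ≤ 1 ∧ (1 - ε) * s ≤ f a ∧ (1 - ε) * t ≤ f b}) ?_ ⟨?_, ?_⟩ hp
  · intro z hz
    exact ⟨z, 0, 1, 0, by simp, hz.1, by simp, by simp, by simpa using hz.2.le, by simp⟩
  · rw [balanced_iff_smul_mem]
    rintro r hr _ ⟨a, b, s, t, rfl, ha, hb, hst, hfa, hfb⟩
    rw [Real.norm_eq_abs] at hr
    have hs0 := (norm_nonneg a).trans ha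
    have ht0 := (norm_nonneg b).trans hb
    rcases le_total 0 r with h0 | h0
    · rw [abs_of_nonneg h0] at hr
      refine ⟨r • a, r • b, r * s, r * t, smul_sub _ _ _, ?_, ?_, ?_, ?_, ?_⟩
      · rw [norm_smul, Real.norm_eq_abs, abs_of_nonneg h0]
        exact mul_le_mul_of_nonneg_left ha h0
      · rw [norm_smul, Real.norm_eq_abs, abs_of_nonneg h0]
        exact mul_le_mul_of_nonneg_left hb h0
      · nlinarith
      · rw [map_smul, smul_eq_mul]; nlinarith
      · rw [map_smul, smul_eq_mul]; nlinarith
    · rw [abs_of_nonpos h0] at hr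
      have h1 : 0 ≤ -r := by linarith
      refine ⟨(-r) • b, (-r) • a, -r * t, -r * s, ?_, ?_, ?_, ?_, ?_, ?_⟩
      · rw [smul_sub, neg_smul, neg_smul]; abel
      · rw [norm_smul, Real.norm_eq_abs, abs_of_nonneg h1]
        exact mul_le_mul_of_nonneg_left hb h1
      · rw [norm_smul, Real.norm_eq_abs, abs_of_nonneg h1]
        exact mul_le_mul_of_nonneg_left ha h1
      · nlinarith
      · rw [map_smul, smul_eq_mul]; nlinarith
      · rw [map_smul, smul_eq_mul]; nlinarith
  · rintro _ ⟨a, b, s, t, rfl, ha, hb, hst, hfa, hfb⟩ _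
      ⟨a', b', s', t', rfl, ha', hb', hst', hfa', hfb'⟩ α β hα hβ hαβ
    have hcomb : ∀ (x x' : X) (q q' : ℝ), ‖x‖ ≤ q → ‖x'‖ ≤ q' →
        ‖α • x + β • x'‖ ≤ α * q + β * q' := by
      intro x x' q q' hx hx'
      refine (norm_add_le _ _).trans ?_
      rw [norm_smul, norm_smul, Real.norm_eq_abs, Real.norm_eq_abs, abs_of_nonneg hα,
        abs_of_nonneg hβ]
      exact add_le_add (mul_le_mul_of_nonneg_left hx hα) (mul_le_mul_of_nonneg_left hx' hβ)
    refine ⟨α • a + β • a', α • b + β • b', α * s + β * s', α * t + β * t', ?_,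
      hcomb _ _ _ _ ha ha', hcomb _ _ _ _ hb hb', ?_, ?_, ?_⟩
    · rw [smul_sub, smul_sub]; abel
    · nlinarith
    · rw [map_add, map_smul, map_smul, smul_eq_mul, smul_eq_mul]; nlinarith
    · rw [map_add, map_smul, map_smul, smul_eq_mul, smul_eq_mul]; nlinarith

theorem exists_norm_one_smul_eq {X : Type*} [NormedAddCommGroup X] [NormedSpace ℝ X]
    [Nontrivial X] (x : X) : ∃ x' : X, ‖x'‖ = 1 ∧ ‖x‖ • x' = x := by
  rcases eq_or_ne x 0 with rfl | hx
  · obtain ⟨u, hu⟩ := exists_ne (0 : X)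
    exact ⟨‖u‖⁻¹ • u, norm_smul_inv_norm (𝕜 := ℝ) hu, by simp⟩
  · exact ⟨‖x‖⁻¹ • x, norm_smul_inv_norm (𝕜 := ℝ) hx,
      smul_inv_smul₀ (norm_ne_zero_iff.2 hx) x⟩

/-- The slice functional is nearly norming at `x` and at both parts of a point of the hull close to
`y / ‖y‖`, so it witnesses that the norms of `x`, `a`, `b` almost add up. -/
theorem IsLush.splitsLushly {X : Type*} [NormedAddCommGroup X] [NormedSpace ℝ X] [Nontrivial X]
    (hX : IsLush X) : SplitsLushly X := by
  intro x y ε hε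
  obtain ⟨x', hx', hxx⟩ := exists_norm_one_smul_eq x
  obtain ⟨y', hy', hyy⟩ := exists_norm_one_smul_eq y
  have hx0 := norm_nonneg x
  have hy0 := norm_nonneg y
  -- The losses are below `τ * ‖y‖ + τ` and `τ * (‖x‖ + 3)`; `τ ≤ 1` keeps the factor `1 - τ`
  -- nonnegative.
  set τ : ℝ := min 1 (ε / (‖x‖ + ‖y‖ + 3)) with hτ
  have hτ0 : 0 < τ := lt_min one_pos (by positivity)
  have hτ1 : τ ≤ 1 := min_le_left _ _
  have hτε : τ * (‖x‖ + ‖y‖ + 3) ≤ ε := by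
    rw [← le_div_iff₀ (by positivity)]
    exact min_le_right _ _
  obtain ⟨f, hf, hxf, hdist⟩ := hX x' y' hx' hy' τ hτ0
  have hne : (absConvexHull ℝ (ballSlice f τ)).Nonempty := ⟨x', subset_absConvexHull hxf⟩
  obtain ⟨p, hp, hyp⟩ := (Metric.infDist_lt_iff hne).1 hdist
  obtain ⟨a, b, s, t, rfl, ha, hb, hst, hfa, hfb⟩ :=
    exists_sub_of_mem_absConvexHull_ballSlice hp
  rw [dist_eq_norm] at hyp
  refine ⟨a, b, by linarith, ?_, ?_⟩
  · have h1 : y - ‖y‖ • (a - b) = ‖y‖ • (y' - (a - b)) := by rw [smul_sub ‖y‖ y', hyy]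
    rw [h1, norm_smul, norm_norm]
    nlinarith
  · have h1 : 1 - τ ≤ s + t := by
      have h2 := norm_sub_norm_le y' (a - b)
      have h3 := norm_sub_le a b
      linarith
    have h4 : f (x + (a + b)) ≤ ‖x + (a + b)‖ := by
      have := f.le_opNorm (x + (a + b))
      rw [hf, one_mul] at this
      exact (le_abs_self _).trans this
    have h5 : f x = ‖x‖ * f x' := by
      conv_lhs => rw [← hxx]
      rw [map_smul, smul_eq_mul]
    have h6 : 1 - τ < f x' := hxf.2
    rw [map_add, map_add, h5] at h4
    have h7 : ‖x‖ * (1 - τ) ≤ ‖x‖ * f x' := mul_le_mul_of_nonneg_left h6.le hx0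
    have h8 : (1 - τ) * (1 - τ) ≤ (1 - τ) * (s + t) :=
      mul_le_mul_of_nonneg_left h1 (by linarith)
    nlinarith

theorem SplitsLushly.exists_scaled {X : Type*} [NormedAddCommGroup X] [NormedSpace ℝ X]
    (hX : SplitsLushly X) (x y : X) {ε ε' c : ℝ} (hε : 0 < ε) (hε' : 0 < ε') (hc : 0 < c) :
    ∃ a b : X, ‖a‖ + ‖b‖ ≤ 1 ∧ ‖y - ‖y‖ • (a - b)‖ < ε' ∧
      ‖x‖ + c - ε ≤ ‖x + c • (a + b)‖ := by
  obtain ⟨a, b, hab, hy, hx⟩ := hX (c⁻¹ • x) y (min ε' (ε / c)) (lt_min hε' (by positivity))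
  refine ⟨a, b, hab, hy.trans_le (min_le_left _ _), ?_⟩
  have h1 : x + c • (a + b) = c • (c⁻¹ • x + (a + b)) := by
    rw [smul_add c (c⁻¹ • x), smul_inv_smul₀ hc.ne']
  have h2 : c * ‖c⁻¹ • x‖ = ‖x‖ := by
    rw [norm_smul, norm_inv, Real.norm_eq_abs, abs_of_pos hc, mul_inv_cancel_left₀ hc.ne']
  have h3 : c * min ε' (ε / c) ≤ ε := by
    have := mul_le_mul_of_nonneg_left (min_le_right ε' (ε / c)) hc.le
    rwa [mul_div_cancel₀ _ hc.ne'] at this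
  rw [h1, norm_smul, Real.norm_eq_abs, abs_of_pos hc]
  have := mul_le_mul_of_nonneg_left hx.le hc.le
  linarith

/-- A set closed under rational linear combinations has a linear subspace as its closure. -/
theorem exists_submodule_coe_eq_closure {X : Type*} [NormedAddCommGroup X] [NormedSpace ℝ X]
    {D : Set X} (hne : D.Nonempty)
    (hD : ∀ x ∈ D, ∀ y ∈ D, ∀ p q : ℚ, (p : ℝ) • x + (q : ℝ) • y ∈ D) :
    ∃ E : Submodule ℝ X, (E : Set X) = closure D := by
  refine ⟨{ carrier := closure D, add_mem' := ?_, zero_mem' := ?_, smul_mem' := ?_ }, rfl⟩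
  · intro x y hx hy
    refine map_mem_closure₂ continuous_add hx hy fun x hx y hy => ?_
    simpa using hD x hx y hy 1 1
  · obtain ⟨x, hx⟩ := hne
    refine subset_closure ?_
    simpa using hD x hx x hx 0 0
  · intro c x hx
    have hc : c ∈ closure (Set.range ((↑) : ℚ → ℝ)) := Rat.isDenseEmbedding_coe_real.dense c
    refine map_mem_closure₂ continuous_smul hc hx ?_
    rintro _ ⟨q, rfl⟩ x hx
    simpa using hD x hx x hx q 0

/-- Close an independent sequence under rational combinations and the chosen witnesses `A`, `B`. The
result is countable, its closure is a subspace, and the splitting inequalities pass to the closure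
by approximation. -/
theorem SplitsLushly.exists_separable_submodule {X : Type*} [NormedAddCommGroup X]
    [NormedSpace ℝ X] (hX : SplitsLushly X) (hdim : ¬ FiniteDimensional ℝ X) :
    ∃ E : Submodule ℝ X, IsClosed (E : Set X) ∧ TopologicalSpace.SeparableSpace E ∧
      ¬ FiniteDimensional ℝ E ∧ SplitsLushly E := by
  choose A B hAB hy hx using fun (x y : X) (k : ℕ) =>
    hX x y (1 / ((k : ℝ) + 1)) (by positivity)
  obtain ⟨v, hv⟩ : ∃ v : ℕ → X, LinearIndependent ℝ v := by
    let b := Module.Basis.ofVectorSpace ℝ X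
    have hinf : Infinite (Module.Basis.ofVectorSpaceIndex ℝ X) := by
      by_contra h
      rw [not_infinite_iff_finite] at h
      exact hdim (Module.Finite.of_basis b)
    exact ⟨_, b.linearIndependent.comp _ (Infinite.natEmbedding _).injective⟩
  let F : Set X → Set X := fun S =>
    (⋃ p : ℚ, ⋃ q : ℚ, Set.image2 (fun x y => (p : ℝ) • x + (q : ℝ) • y) S S) ∪
      ((⋃ k : ℕ, Set.image2 (fun x y => A x y k) S S) ∪
        ⋃ k : ℕ, Set.image2 (fun x y => B x y k) S S)
  have hFc : ∀ S : Set X, S.Countable → (F S).Countable := fun S hS =>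
    (Set.countable_iUnion fun p => Set.countable_iUnion fun q => hS.image2 hS _).union
      ((Set.countable_iUnion fun k => hS.image2 hS _).union
        (Set.countable_iUnion fun k => hS.image2 hS _))
  have hFlin : ∀ S : Set X, ∀ x ∈ S, ∀ y ∈ S, ∀ p q : ℚ, (p : ℝ) • x + (q : ℝ) • y ∈ F S :=
    fun S x hx y hy p q =>
      Or.inl (Set.mem_iUnion₂.2 ⟨p, q, Set.mem_image2_of_mem hx hy⟩)
  have hFA : ∀ S : Set X, ∀ x ∈ S, ∀ y ∈ S, ∀ k, A x y k ∈ F S := fun S x hx y hy k =>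
    Or.inr (Or.inl (Set.mem_iUnion.2 ⟨k, Set.mem_image2_of_mem hx hy⟩))
  have hFB : ∀ S : Set X, ∀ x ∈ S, ∀ y ∈ S, ∀ k, B x y k ∈ F S := fun S x hx y hy k =>
    Or.inr (Or.inr (Set.mem_iUnion.2 ⟨k, Set.mem_image2_of_mem hx hy⟩))
  let Ds : ℕ → Set X := fun n => Nat.rec (Set.range v) (fun _ S => F S) n
  have hDs : ∀ n, Ds (n + 1) = F (Ds n) := fun n => rfl
  have hDm : Monotone Ds := monotone_nat_of_le_succ fun n x hx => by
    rw [hDs]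
    simpa using hFlin (Ds n) x hx x hx 1 0
  have hDc : ∀ n, (Ds n).Countable := fun n => by
    induction n with
    | zero => exact Set.countable_range v
    | succ n ih => exact hFc _ ih
  let D : Set X := ⋃ n, Ds n
  have hDcount : D.Countable := Set.countable_iUnion hDc
  have hpair : ∀ x ∈ D, ∀ y ∈ D, ∃ n, x ∈ Ds n ∧ y ∈ Ds n := by
    intro x hx y hy
    obtain ⟨i, hi⟩ := Set.mem_iUnion.1 hx
    obtain ⟨j, hj⟩ := Set.mem_iUnion.1 hy
    exact ⟨max i j, hDm (le_max_left _ _) hi, hDm (le_max_right _ _) hj⟩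
  have hFD : ∀ n, F (Ds n) ⊆ D := fun n => Set.subset_iUnion Ds (n + 1)
  have hvD : ∀ n, v n ∈ D := fun n => Set.mem_iUnion.2 ⟨0, n, rfl⟩
  obtain ⟨E, hE⟩ := exists_submodule_coe_eq_closure (D := D) ⟨v 0, hvD 0⟩ (by
    intro x hx y hy p q
    obtain ⟨n, hxn, hyn⟩ := hpair x hx y hy
    exact hFD n (hFlin _ x hxn y hyn p q))
  have hDE : ∀ x ∈ D, x ∈ E := fun x hx => by
    rw [← SetLike.mem_coe, hE]; exact subset_closure hx
  refine ⟨E, hE ▸ isClosed_closure, ?_, ?_, ?_⟩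
  · have : TopologicalSpace.IsSeparable (E : Set X) := by
      rw [hE]; exact hDcount.isSeparable.closure
    exact this.separableSpace
  · intro hfin
    have hw : LinearIndependent ℝ (fun n => (⟨v n, hDE _ (hvD n)⟩ : E)) :=
      LinearIndependent.of_comp E.subtype hv
    exact not_finite_iff_infinite.2 (inferInstance : Infinite ℕ) hw.finite
  · rintro ⟨x, hxE⟩ ⟨y, hyE⟩ ε hε
    have hxc : x ∈ closure D := hE ▸ hxE
    have hyc : y ∈ closure D := hE ▸ hyE
    obtain ⟨x', hx'D, hxx⟩ := Metric.mem_closure_iff.1 hxc (ε / 5) (by positivity)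
    obtain ⟨y', hy'D, hyy⟩ := Metric.mem_closure_iff.1 hyc (ε / 5) (by positivity)
    obtain ⟨k, hk⟩ := exists_nat_one_div_lt (show 0 < ε / 5 by positivity)
    rw [dist_eq_norm] at hxx hyy
    obtain ⟨n, hxn, hyn⟩ := hpair x' hx'D y' hy'D
    refine ⟨⟨A x' y' k, hDE _ (hFD n (hFA _ _ hxn _ hyn k))⟩,
      ⟨B x' y' k, hDE _ (hFD n (hFB _ _ hxn _ hyn k))⟩, hAB x' y' k, ?_, ?_⟩
    · change ‖y - ‖y‖ • (A x' y' k - B x' y' k)‖ < ε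
      set w := A x' y' k - B x' y' k with hw
      have hwn : ‖w‖ ≤ 1 := (norm_sub_le _ _).trans (hAB x' y' k)
      have h1 : y - ‖y‖ • w = (y - y') + (y' - ‖y'‖ • w) + (‖y'‖ - ‖y‖) • w := by
        rw [sub_smul]; abel
      have h2 : ‖(‖y'‖ - ‖y‖) • w‖ ≤ ε / 5 := by
        rw [norm_smul, Real.norm_eq_abs, abs_sub_comm]
        refine (mul_le_of_le_one_right (abs_nonneg _) hwn).trans ?_
        exact (abs_norm_sub_norm_le y y').trans hyy.le
      have h3 := hy x' y' k
      rw [h1]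
      have h4 := norm_add₃_le (a := y - y') (b := y' - ‖y'‖ • w) (c := (‖y'‖ - ‖y‖) • w)
      linarith
    · change ‖x‖ + 1 - ε < ‖x + (A x' y' k + B x' y' k)‖
      set w := A x' y' k + B x' y' k with hw
      have h1 := hx x' y' k
      have h2 := norm_sub_norm_le (x' + w) (x + w)
      rw [add_sub_add_right_eq_sub, norm_sub_rev] at h2
      have h3 := norm_sub_norm_le x x'
      linarith

/-! ### Spear functionals and their boundary -/

/-- If `u (n + 1) = u n + 2⁻ⁿ⁻¹ v n` and the norms of `u n` grow almost as fast as possible, then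
some functional in the dual ball is almost `1` at all `v n`, and almost norms `u 0`. -/
theorem exists_dual_of_norm_growth {Z : Type*} [NormedAddCommGroup Z] [NormedSpace ℝ Z]
    [CompleteSpace Z] {u v : ℕ → Z} {ε : ℝ} (hv : ∀ n, ‖v n‖ ≤ 1)
    (hu : ∀ n, u (n + 1) = u n + ((1 : ℝ) / 2) ^ (n + 1) • v n)
    (hgrow : ∀ n, ‖u n‖ + (1 / 2) ^ (n + 1) - 3 / 4 * ε * (1 / 4) ^ (n + 1) ≤ ‖u (n + 1)‖) :
    ∃ g : StrongDual ℝ Z, ‖g‖ ≤ 1 ∧ ‖u 0‖ - ε / 4 ≤ g (u 0) ∧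
      ∀ n, 1 - ε * (1 / 2) ^ (n + 1) ≤ g (v n) := by
  have hdist : ∀ n, dist (u n) (u (n + 1)) ≤ 1 / 2 * (1 / 2) ^ n := by
    intro n
    rw [dist_eq_norm, hu, sub_add_cancel_left, norm_neg, norm_smul, Real.norm_eq_abs,
      abs_of_pos (by positivity), pow_succ]
    have : (0 : ℝ) < (1 / 2) ^ n := by positivity
    nlinarith [hv n, norm_nonneg (v n)]
  obtain ⟨w, hw⟩ := cauchySeq_tendsto_of_complete
    (cauchySeq_of_le_geometric (1 / 2) (1 / 2) (by norm_num) hdist)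
  have hwd : ∀ n, ‖w - u n‖ ≤ (1 / 2) ^ n := by
    intro n
    have := dist_le_of_le_geometric_of_tendsto (1 / 2) (1 / 2) (by norm_num) hdist hw n
    rw [dist_comm, dist_eq_norm] at this
    refine this.trans (le_of_eq ?_)
    ring
  -- The factor `3 / 4` is what makes the allowed losses telescope to `ε * (1 / 4) ^ (n + 1)`.
  have hmono : Monotone fun n => ‖u n‖ + (1 / 2) ^ n - ε * (1 / 4) ^ (n + 1) := by
    refine monotone_nat_of_le_succ fun n => ?_
    have := hgrow n
    have h1 : ((1 : ℝ) / 2) ^ n = 2 * (1 / 2) ^ (n + 1) := by ring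
    have h2 : ((1 : ℝ) / 4) ^ (n + 1 + 1) = 1 / 4 * (1 / 4) ^ (n + 1) := by ring
    rw [h1, h2]
    linarith
  have hlim : Filter.Tendsto (fun n => ‖u n‖ + (1 / 2) ^ n - ε * (1 / 4) ^ (n + 1))
      Filter.atTop (nhds ‖w‖) := by
    have h1 : Filter.Tendsto (fun n : ℕ => ((1 : ℝ) / 2) ^ n) Filter.atTop (nhds 0) :=
      tendsto_pow_atTop_nhds_zero_of_lt_one (by norm_num) (by norm_num)
    have h2 : Filter.Tendsto (fun n : ℕ => ((1 : ℝ) / 4) ^ (n + 1)) Filter.atTop (nhds 0) :=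
      (tendsto_pow_atTop_nhds_zero_of_lt_one (by norm_num) (by norm_num)).comp
        (Filter.tendsto_add_atTop_nat 1)
    have := (hw.norm.add h1).sub (h2.const_mul ε)
    simpa using this
  have hle : ∀ n, ‖u n‖ + (1 / 2) ^ n - ε * (1 / 4) ^ (n + 1) ≤ ‖w‖ := hmono.ge_of_tendsto hlim
  -- A functional norming the limit `w` must gain almost the maximum at every step of the path to
  -- `w`.
  obtain ⟨g, hg, hgw⟩ := exists_dual_vector'' ℝ w
  have hgw' : g w = ‖w‖ := hgw
  have hgle : ∀ z, g z ≤ ‖z‖ := fun z =>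
    (le_abs_self _).trans ((g.le_opNorm z).trans (mul_le_of_le_one_left (norm_nonneg _) hg))
  have hgu : ∀ n, ‖w‖ - (1 / 2) ^ n ≤ g (u n) := by
    intro n
    have h1 := (hgle (w - u n)).trans (hwd n)
    rw [map_sub, hgw'] at h1
    linarith
  refine ⟨g, hg, ?_, fun n => ?_⟩
  · have h1 := hgu 0
    have h2 := hle 0
    norm_num at h1 h2
    linarith
  · have h1 := hgu (n + 1)
    have h2 := hle n
    have h3 := hgle (u n)
    rw [hu, map_add, map_smul, smul_eq_mul] at h1
    have h4 : ((1 : ℝ) / 2) ^ n = 2 * (1 / 2) ^ (n + 1) := by ring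
    have h5 : ((1 : ℝ) / 4) ^ (n + 1) = (1 / 2) ^ (n + 1) * (1 / 2) ^ (n + 1) := by
      rw [← mul_pow]; norm_num
    rw [h4, h5] at h2
    have h6 : (0 : ℝ) < (1 / 2) ^ (n + 1) := by positivity
    refine le_of_mul_le_mul_left ?_ h6
    linarith

/-- Spear vectors of a real normed space. -/
def IsSpear {Y : Type*} [NormedAddCommGroup Y] (g : Y) : Prop :=
  ‖g‖ ≤ 1 ∧ ∀ h : Y, ‖h‖ + 1 ≤ max ‖h + g‖ ‖h - g‖

theorem IsSpear.exists_sign {Y : Type*} [NormedAddCommGroup Y] [NormedSpace ℝ Y] {g : Y}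
    (hg : IsSpear g) (h : Y) {c : ℝ} (hc : 0 < c) :
    ∃ θ : ℝ, |θ| = 1 ∧ ‖h‖ + c ≤ ‖h + c • (θ • g)‖ := by
  have h2 : c * ‖c⁻¹ • h‖ = ‖h‖ := by
    rw [norm_smul, norm_inv, Real.norm_eq_abs, abs_of_pos hc, mul_inv_cancel_left₀ hc.ne']
  have h1 : ∀ w : Y, ‖h + c • w‖ = c * ‖c⁻¹ • h + w‖ := by
    intro w
    have : h + c • w = c • (c⁻¹ • h + w) := by rw [smul_add, smul_inv_smul₀ hc.ne']
    rw [this, norm_smul, Real.norm_eq_abs, abs_of_pos hc]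
  rcases le_max_iff.1 (hg.2 (c⁻¹ • h)) with h3 | h3
  · refine ⟨1, abs_one, ?_⟩
    rw [h1, one_smul]
    have := mul_le_mul_of_nonneg_left h3 hc.le
    linarith
  · refine ⟨-1, by rw [abs_neg, abs_one], ?_⟩
    rw [h1, neg_one_smul, ← sub_eq_add_neg]
    have := mul_le_mul_of_nonneg_left h3 hc.le
    linarith

/-- The functionals of modulus one on a sequence of spear vectors form a boundary. -/
theorem exists_norming_of_isSpear {Y : Type*} [NormedAddCommGroup Y] [NormedSpace ℝ Y]
    [CompleteSpace Y] {g : ℕ → Y} (hg : ∀ n, IsSpear (g n)) (h : Y) :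
    ∃ e : StrongDual ℝ Y, (‖e‖ ≤ 1 ∧ ∀ n, |e (g n)| = 1) ∧ e h = ‖h‖ := by
  choose θ hθ hθn using fun (n : ℕ) (u : Y) =>
    (hg n).exists_sign u (show (0 : ℝ) < (1 / 2) ^ (n + 1) by positivity)
  let u : ℕ → Y := fun n => Nat.rec h (fun n u => u + ((1 : ℝ) / 2) ^ (n + 1) • (θ n u • g n)) n
  -- Spears allow norm growth with no loss, so `ε = 0` gives exact equalities.
  obtain ⟨e, he, heh, hev⟩ := exists_dual_of_norm_growth (u := u) (v := fun n => θ n (u n) • g n)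
    (ε := 0)
    (fun n => by rw [norm_smul, Real.norm_eq_abs, hθ, one_mul]; exact (hg n).1)
    (fun n => rfl) (fun n => by
      rw [mul_zero, zero_mul, sub_zero]
      exact hθn n (u n))
  have hle : ∀ z, |e z| ≤ ‖z‖ := fun z =>
    (e.le_opNorm z).trans (mul_le_of_le_one_left (norm_nonneg _) he)
  refine ⟨e, ⟨he, fun n => le_antisymm ((hle _).trans (hg n).1) ?_⟩, ?_⟩
  · have h1 := hev n
    rw [zero_mul, sub_zero, map_smul, smul_eq_mul] at h1
    have h2 := h1.trans (le_abs_self _)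
    rwa [abs_mul, hθ, one_mul] at h2
  · rw [zero_div, sub_zero] at heh
    exact le_antisymm ((le_abs_self _).trans (hle h)) heh

/-- A path from `x` with steps `a n + b n` yields `g` almost `1` on each step. If `a n - b n` nearly
norms `h`, then `‖h‖ + 1` is about `(h + g) a - (h - g) b`, bounded by the maximum because `‖a‖ +
‖b‖ ≤ 1`. -/
theorem SplitsLushly.exists_isSpear {E : Type*} [NormedAddCommGroup E] [NormedSpace ℝ E]
    [CompleteSpace E] [TopologicalSpace.SeparableSpace E] (hE : SplitsLushly E) {x : E}
    (hx : x ≠ 0) : ∃ g : StrongDual ℝ E, IsSpear g ∧ g x ≠ 0 := by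
  have hxp : 0 < ‖x‖ := norm_pos_iff.2 hx
  -- Unpairing repeats each dense point at arbitrarily late stages, where the errors are small.
  let y : ℕ → E := fun n => TopologicalSpace.denseSeq E n.unpair.1
  -- Scaling the losses by `‖x‖` leaves `g x ≥ 3 / 4 * ‖x‖`.
  choose a b hab hy hgrow using fun (n : ℕ) (u : E) =>
    hE.exists_scaled u (y n) (ε := 3 / 4 * ‖x‖ * (1 / 4) ^ (n + 1)) (ε' := (1 / 2) ^ n)
      (c := (1 / 2) ^ (n + 1)) (by positivity) (by positivity) (by positivity)
  let u : ℕ → E := fun n =>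
    Nat.rec x (fun n u => u + ((1 : ℝ) / 2) ^ (n + 1) • (a n u + b n u)) n
  obtain ⟨g, hg, hgx, hgv⟩ := exists_dual_of_norm_growth (u := u)
    (v := fun n => a n (u n) + b n (u n))
    (fun n => (norm_add_le _ _).trans (hab n _)) (fun n => rfl) (fun n => hgrow n (u n))
  have hgx' : ‖x‖ - ‖x‖ / 4 ≤ g x := hgx
  refine ⟨g, ⟨hg, fun h => ?_⟩, by intro h0; rw [h0] at hgx'; linarith⟩
  have hmain : ∀ (n : ℕ) (τ : ℝ), ‖h‖ - τ ≤ h (a n (u n) - b n (u n)) →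
      ‖h‖ - τ + (1 - ‖x‖ * (1 / 2) ^ (n + 1)) ≤ max ‖h + g‖ ‖h - g‖ := by
    intro n τ hτ
    have h1 := hgv n
    set p := a n (u n)
    set q := b n (u n)
    have h2 : (h + g) p ≤ max ‖h + g‖ ‖h - g‖ * ‖p‖ :=
      (le_abs_self _).trans (((h + g).le_opNorm p).trans
        (mul_le_mul_of_nonneg_right (le_max_left _ _) (norm_nonneg _)))
    have h3 : -((h - g) q) ≤ max ‖h + g‖ ‖h - g‖ * ‖q‖ :=
      (neg_le_abs _).trans (((h - g).le_opNorm q).trans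
        (mul_le_mul_of_nonneg_right (le_max_right _ _) (norm_nonneg _)))
    have h4 : max ‖h + g‖ ‖h - g‖ * (‖p‖ + ‖q‖) ≤ max ‖h + g‖ ‖h - g‖ :=
      mul_le_of_le_one_right ((norm_nonneg _).trans (le_max_left _ _)) (hab n (u n))
    rw [map_sub] at hτ
    rw [map_add] at h1
    rw [add_apply] at h2
    rw [sub_apply] at h3
    linarith
  refine le_of_forall_pos_sub_le fun τ hτ => ?_
  have hpow : ∀ r : ℝ, 0 < r → ∃ N : ℕ, ∀ n, N ≤ n → ((1 : ℝ) / 2) ^ n < r := fun r hr => by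
    have h1 : Filter.Tendsto (fun n : ℕ => ((1 : ℝ) / 2) ^ n) Filter.atTop (nhds 0) :=
      tendsto_pow_atTop_nhds_zero_of_lt_one (by norm_num) (by norm_num)
    exact Filter.eventually_atTop.1 (h1.eventually_lt_const hr)
  obtain ⟨N, hN⟩ := hpow (τ / 3 / ‖x‖) (by positivity)
  have hNx : ∀ n, N ≤ n → ‖x‖ * (1 / 2) ^ (n + 1) ≤ τ / 3 := fun n hn => by
    have := (hN (n + 1) (by omega)).le
    rwa [le_div_iff₀ hxp, mul_comm] at this
  rcases eq_or_ne h 0 with h0 | h0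
  · have h1 := hmain N 0 (by rw [h0]; simp)
    have h2 := hNx N le_rfl
    linarith
  have hhp : 0 < ‖h‖ := norm_pos_iff.2 h0
  -- The bound `‖h‖ / 3` makes `h w` positive below, so the factor `‖t‖ < 1` can be dropped.
  set ρ : ℝ := min (τ / 3) (‖h‖ / 3) with hρ
  have hρ0 : 0 < ρ := lt_min (by positivity) (by positivity)
  have hρτ : ρ ≤ τ / 3 := min_le_left _ _
  have hρh : ρ ≤ ‖h‖ / 3 := min_le_right _ _
  obtain ⟨z, hz1, hz2⟩ : ∃ z : E, ‖z‖ < 1 ∧ ‖h‖ - ρ < h z := by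
    obtain ⟨z, hz1, hz2⟩ := h.exists_lt_apply_of_lt_opNorm (show ‖h‖ - ρ < ‖h‖ by linarith)
    rw [Real.norm_eq_abs] at hz2
    rcases abs_cases (h z) with ⟨h, -⟩ | ⟨h, -⟩
    · exact ⟨z, hz1, by linarith⟩
    · exact ⟨-z, by rwa [norm_neg], by rw [map_neg]; linarith⟩
  have hopen : IsOpen {z : E | ‖z‖ < 1 ∧ ‖h‖ - ρ < h z} :=
    (isOpen_lt continuous_norm continuous_const).inter (isOpen_lt continuous_const h.continuous)
  obtain ⟨i, hi1, hi2⟩ := (TopologicalSpace.denseRange_denseSeq E).exists_mem_open hopen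
    ⟨z, hz1, hz2⟩
  obtain ⟨N', hN'⟩ := hpow (ρ / ‖h‖) (by positivity)
  set n := Nat.pair i (max N N') with hn
  have hnN : max N N' ≤ n := Nat.right_le_pair _ _
  have hyn : y n = TopologicalSpace.denseSeq E i := by simp [y, hn]
  have h1 := hmain n (2 * ρ) (by
    have h2 := hy n (u n)
    rw [hyn] at h2
    set w := a n (u n) - b n (u n)
    set t := TopologicalSpace.denseSeq E i
    have h3 : h (t - ‖t‖ • w) ≤ ρ := by
      refine (le_abs_self _).trans ((h.le_opNorm _).trans ?_)
      have h4 := (hN' n ((le_max_right _ _).trans hnN)).le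
      rw [le_div_iff₀ hhp, mul_comm] at h4
      exact (mul_le_mul_of_nonneg_left h2.le hhp.le).trans h4
    rw [map_sub, map_smul, smul_eq_mul] at h3
    have h5 : ‖h‖ - 2 * ρ ≤ ‖t‖ * h w := by linarith
    have h6 : 0 < ‖t‖ * h w := by linarith
    have h7 : 0 < h w := pos_of_mul_pos_right h6 (norm_nonneg _)
    have h8 := mul_le_of_le_one_left h7.le hi1.le
    linarith)
  have h9 := hNx n ((le_max_left _ _).trans hnN)
  linarith

/-- Spears separate points, so finitely many would embed `E` linearly into a finite-dimensional
space. -/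
theorem SplitsLushly.infinite_setOf_isSpear {E : Type*} [NormedAddCommGroup E] [NormedSpace ℝ E]
    [CompleteSpace E] [TopologicalSpace.SeparableSpace E] (hE : SplitsLushly E)
    (hdim : ¬ FiniteDimensional ℝ E) : {g : StrongDual ℝ E | IsSpear g}.Infinite := by
  intro hfin
  have : Finite {g : StrongDual ℝ E | IsSpear g} := hfin
  let L : E →ₗ[ℝ] ({g : StrongDual ℝ E | IsSpear g} → ℝ) :=
    LinearMap.pi fun g => (g.1 : E →ₗ[ℝ] ℝ)
  refine hdim (FiniteDimensional.of_injective L ?_)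
  rw [injective_iff_map_eq_zero]
  intro x hx
  by_contra hx0
  obtain ⟨g, hg, hgx⟩ := hE.exists_isSpear hx0
  exact hgx (congrFun hx ⟨g, hg⟩)

/-! ### From spears to ℓ₁ -/

/-- The dual of a space with infinitely many spear functionals contains an `ℓ₁`-sequence. -/
theorem hasEllOneSequence_of_isSpear {E : Type*} [NormedAddCommGroup E] [NormedSpace ℝ E]
    {g : ℕ → StrongDual ℝ E} (hinj : Function.Injective g) (hg : ∀ n, IsSpear (g n)) :
    HasEllOneSequence (StrongDual ℝ E) := by
  let T : Set (StrongDual ℝ (StrongDual ℝ E)) := {e | ‖e‖ ≤ 1 ∧ ∀ n, |e (g n)| = 1}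
  have hbd : ∀ h : StrongDual ℝ E, ∃ e ∈ T, e h = ‖h‖ := exists_norming_of_isSpear hg
  have hval : ∀ e ∈ T, ∀ n, e (g n) = if 0 < e (g n) then 1 else -1 := by
    intro e he n
    have h1 := he.2 n
    split_ifs with h
    · rwa [abs_of_pos h] at h1
    · rw [abs_of_nonpos (not_lt.1 h)] at h1
      linarith
  rcases exists_convergent_or_independent_subsequence
    (fun (n : ℕ) (e : T) => decide (0 < e.1 (g n))) with ⟨φ, hφ, hconv⟩ | ⟨φ, hφ, hind⟩
  -- Each boundary point sees only finitely many nonzero differences. The differences take values in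
  -- `{-2, 0, 2}` on the boundary, so distinctness of the spears bounds them away from zero.
  · obtain ⟨z, ε, hε, hz, hzε⟩ := exists_boundedSubsums_of_summable_on_boundary
      (T := T) (d := fun n => g (φ (n + 1)) - g (φ n)) (fun e he => he.1) hbd
      (fun e he => by
        obtain ⟨b, N, hN⟩ := hconv ⟨e, he⟩
        refine summable_of_ne_finset_zero (s := Finset.range N) fun n hn => ?_
        rw [Finset.mem_range, not_lt] at hn
        have h1 := hN n hn
        have h2 := hN (n + 1) (by omega)
        have h3 : (0 < e (g (φ (n + 1)))) ↔ (0 < e (g (φ n))) := by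
          rw [← decide_eq_decide, h1, h2]
        rw [abs_eq_zero, map_sub, hval e he, hval e he (φ n)]
        simp only [h3, sub_self])
      one_pos (fun n => by
        have hne : g (φ (n + 1)) - g (φ n) ≠ 0 :=
          sub_ne_zero.2 fun h => (hφ (Nat.lt_succ_self n)).ne' (hinj h)
        have hpos := norm_pos_iff.2 hne
        obtain ⟨e, he, hen⟩ := hbd (g (φ (n + 1)) - g (φ n))
        rw [← hen] at hpos ⊢
        rw [map_sub, hval e he, hval e he (φ n)] at hpos ⊢
        split_ifs at hpos ⊢ <;> linarith)
    exact hz.hasEllOneSequence hε hzε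
  · refine ⟨fun n => g (φ n), ⟨1, fun n => (hg _).1⟩, 1, one_pos, fun s c => ?_⟩
    obtain ⟨k, hk⟩ := s.exists_nat_subset_range
    -- Independence supplies a boundary functional whose signs match those of `c`.
    obtain ⟨⟨e, he⟩, hek⟩ := hind (fun i => decide (0 ≤ c i)) k
    have h1 : e (∑ i ∈ s, c i • g (φ i)) = ∑ i ∈ s, |c i| := by
      rw [map_sum]
      refine Finset.sum_congr rfl fun i hi => ?_
      have h2 : (0 < e (g (φ i))) ↔ 0 ≤ c i := by
        rw [← decide_eq_decide]
        exact hek i (Finset.mem_range.1 (hk hi))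
      rw [map_smul, smul_eq_mul, hval e he]
      simp only [h2]
      split_ifs with h
      · rw [abs_of_nonneg h, mul_one]
      · rw [abs_of_neg (not_le.1 h), mul_neg_one]
    rw [one_mul, ← h1]
    exact (le_abs_self _).trans
      ((e.le_opNorm _).trans (mul_le_of_le_one_left (norm_nonneg _) he.1))

theorem corollary4p9 (X : Type*) [NormedAddCommGroup X] [NormedSpace ℝ X] [CompleteSpace X]
    (hdim : ¬ FiniteDimensional ℝ X) (hlush : IsLush X) :
    ContainsIsomorphicCopy (StrongDual ℝ X) (lp (fun _ : ℕ => ℝ) 1) := by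
  have hnt : Nontrivial X := by
    by_contra h
    rw [not_nontrivial_iff_subsingleton] at h
    exact hdim inferInstance
  obtain ⟨E, hclosed, hsep, hEdim, hE⟩ := hlush.splitsLushly.exists_separable_submodule hdim
  have : CompleteSpace E := hclosed.completeSpace_coe
  have hinf := hE.infinite_setOf_isSpear hEdim
  refine (HasEllOneSequence.of_dual_submodule E ?_).containsIsomorphicCopy
  exact hasEllOneSequence_of_isSpear
    (g := fun n => (hinf.natEmbedding _ n : StrongDual ℝ E))
    (Subtype.val_injective.comp (hinf.natEmbedding _).injective)
    (fun n => (hinf.natEmbedding _ n).2)
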